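/- Let $E$ be a real Banach lattice and let $E'$ be its norm dual, with the dual order ($f\le g$ iff $f(x)\le g(x)$ for all $x\ge 0$). A sequence $(x_n')$ in $E'$ is called $uaw^*$-null if $|x_n'|\wedge u'\to 0$ in the weak$^*$ topology $\sigma(E',E)$ for every $0\le u'\in E'$. Say that $E$ has the *positive Grothendieck property* (PGP) if every weak$^*$-null sequence of positive elements of $E'$ is weakly null, i.e. null for $\sigma(E',E'')$, and that $E$ has the *unbounded Grothendieck property* (UGP) if every norm bounded $uaw^*$-null sequence in $E'$ is weakly null. A Banach lattice is *$\sigma$-order complete* if every nonempty countable subset that is bounded above has a supremum, and *order continuous* if $\inf_{x\in D}\|x\|=0$ for every nonempty downward directed set $D$ with infimum $0$. **Theorem.** Let $E$ be a $\sigma$-order complete Banach lattice whose dual $E'$ is order continuous. 1. If $E$ is order continuous and has the PGP, then $E$ has the UGP. 2. Conversely, if $E$ has the UGP, then $E$ is order continuous. In particular, for such $E$ with the PGP, $E$ has the UGP if and only if $E$ is order continuous. -/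

import Mathlib

open Filter Topology

noncomputable section

namespace BanachLattice

universe u

/-! Throughout, a (real) Banach lattice is a type `E` with
`[NormedAddCommGroup E] [NormedSpace ℝ E] [CompleteSpace E]` (a real Banach space),
`[Lattice E] [IsOrderedAddMonoid E] [IsOrderedModule ℝ E]` (a vector lattice) and
`[HasSolidNorm E]` (`|x| ≤ |y|` implies `‖x‖ ≤ ‖y‖`). -/

/-- The norm dual `E'` of a normed space `E`, with the dual norm. It is a copy of
`StrongDual ℝ E` that will be ordered by `f ≤ g ↔ ∀ x ≥ 0, f x ≤ g x`. -/
def Dual (E : Type u) [NormedAddCommGroup E] [NormedSpace ℝ E] : Type u := StrongDual ℝ E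

section DualNormed

variable {E : Type u} [NormedAddCommGroup E] [NormedSpace ℝ E]

instance : NormedAddCommGroup (Dual E) := inferInstanceAs (NormedAddCommGroup (StrongDual ℝ E))

instance : NormedSpace ℝ (Dual E) := inferInstanceAs (NormedSpace ℝ (StrongDual ℝ E))

instance : FunLike (Dual E) E ℝ := inferInstanceAs (FunLike (StrongDual ℝ E) E ℝ)

instance : ContinuousLinearMapClass (Dual E) ℝ E ℝ :=
  inferInstanceAs (ContinuousLinearMapClass (StrongDual ℝ E) ℝ E ℝ)

@[ext] theorem Dual.ext {f g : Dual E} (h : ∀ x, f x = g x) : f = g :=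
  ContinuousLinearMap.ext h

@[simp] theorem Dual.add_apply (f g : Dual E) (x : E) : (f + g) x = f x + g x := rfl

@[simp] theorem Dual.sub_apply (f g : Dual E) (x : E) : (f - g) x = f x - g x := rfl

@[simp] theorem Dual.neg_apply (f : Dual E) (x : E) : (-f) x = -f x := rfl

@[simp] theorem Dual.smul_apply (c : ℝ) (f : Dual E) (x : E) : (c • f) x = c * f x := rfl

@[simp] theorem Dual.zero_apply (x : E) : (0 : Dual E) x = 0 := rfl

theorem Dual.le_opNorm (f : Dual E) (x : E) : |f x| ≤ ‖f‖ * ‖x‖ :=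
  ContinuousLinearMap.le_opNorm (show StrongDual ℝ E from f) x

end DualNormed

section DualLattice

variable {E : Type u} [NormedAddCommGroup E] [NormedSpace ℝ E]
  [Lattice E] [IsOrderedAddMonoid E] [IsOrderedModule ℝ E] [HasSolidNorm E]

set_option linter.unusedSectionVars false

/-- The dual order: `f ≤ g` iff `f x ≤ g x` for every `x ≥ 0`. -/
instance : PartialOrder (Dual E) where
  le f g := ∀ x : E, 0 ≤ x → f x ≤ g x
  le_refl _ _ _ := le_rfl
  le_trans _ _ _ h₁ h₂ x hx := (h₁ x hx).trans (h₂ x hx)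
  le_antisymm f g h₁ h₂ := by
    have key : ∀ x : E, 0 ≤ x → f x = g x := fun x hx => le_antisymm (h₁ x hx) (h₂ x hx)
    ext x
    rw [← posPart_sub_negPart x, map_sub, map_sub, key _ (posPart_nonneg x),
      key _ (negPart_nonneg x)]

theorem Dual.le_def {f g : Dual E} : f ≤ g ↔ ∀ x : E, 0 ≤ x → f x ≤ g x := Iff.rfl

instance : IsOrderedAddMonoid (Dual E) where
  add_le_add_left f g h k x hx := by
    have := h x hx
    simp only [Dual.add_apply]
    linarith

/-- The values of `f` on the order interval `[0, x]`. -/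
def intervalValues (f : Dual E) (x : E) : Set ℝ := (fun y => f y) '' Set.Icc 0 x

theorem norm_le_of_mem_Icc {x y : E} (hy : y ∈ Set.Icc 0 x) : ‖y‖ ≤ ‖x‖ :=
  norm_le_norm_of_abs_le_abs (by
    rw [abs_of_nonneg hy.1, abs_of_nonneg (hy.1.trans hy.2)]
    exact hy.2)

theorem le_of_mem_intervalValues {f : Dual E} {x : E} {r : ℝ} (hr : r ∈ intervalValues f x) :
    r ≤ ‖f‖ * ‖x‖ := by
  obtain ⟨y, hy, rfl⟩ := hr
  exact (le_abs_self _).trans ((f.le_opNorm y).trans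
    (mul_le_mul_of_nonneg_left (norm_le_of_mem_Icc hy) (norm_nonneg _)))

theorem bddAbove_intervalValues (f : Dual E) (x : E) : BddAbove (intervalValues f x) :=
  ⟨_, fun _ hr => le_of_mem_intervalValues hr⟩

/-- `sup {f y | 0 ≤ y ≤ x}`, the value at `x ≥ 0` of the positive part of `f`. -/
def posValue (f : Dual E) (x : E) : ℝ := sSup (intervalValues f x)

theorem le_posValue (f : Dual E) {x y : E} (h₀ : 0 ≤ y) (h : y ≤ x) : f y ≤ posValue f x :=
  le_csSup (bddAbove_intervalValues f x) ⟨y, ⟨h₀, h⟩, rfl⟩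

theorem posValue_le {f : Dual E} {x : E} (hx : 0 ≤ x) {c : ℝ}
    (h : ∀ y, 0 ≤ y → y ≤ x → f y ≤ c) : posValue f x ≤ c :=
  csSup_le ⟨f 0, 0, ⟨le_rfl, hx⟩, rfl⟩ (by
    rintro _ ⟨y, hy, rfl⟩
    exact h y hy.1 hy.2)

theorem posValue_nonneg (f : Dual E) {x : E} (hx : 0 ≤ x) : 0 ≤ posValue f x := by
  simpa using le_posValue f le_rfl hx

theorem posValue_add (f : Dual E) {x y : E} (hx : 0 ≤ x) (hy : 0 ≤ y) :
    posValue f (x + y) = posValue f x + posValue f y := by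
  apply le_antisymm
  · refine posValue_le (add_nonneg hx hy) fun z hz hzxy => ?_
    have h₁ : f (z ⊓ x) ≤ posValue f x := le_posValue f (le_inf hz hx) inf_le_right
    have h₂ : f (z - z ⊓ x) ≤ posValue f y := by
      refine le_posValue f (sub_nonneg.2 inf_le_left) ?_
      rw [sub_le_comm]
      exact le_inf (sub_le_self z hy) (sub_le_iff_le_add.2 hzxy)
    rw [map_sub] at h₂
    linarith
  · rw [← le_sub_iff_add_le]
    refine posValue_le hx fun a ha hax => ?_
    rw [le_sub_comm]
    refine posValue_le hy fun b hb hby => ?_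
    have := le_posValue f (add_nonneg ha hb) (add_le_add hax hby)
    rw [map_add] at this
    linarith

theorem posValue_smul_le (f : Dual E) {c : ℝ} (hc : 0 < c) {x : E} (hx : 0 ≤ x) :
    posValue f (c • x) ≤ c * posValue f x := by
  refine posValue_le (smul_nonneg hc.le hx) fun y hy hyx => ?_
  have h : c⁻¹ • y ≤ x := by
    have := smul_le_smul_of_nonneg_left hyx (inv_nonneg.2 hc.le)
    rwa [inv_smul_smul₀ hc.ne'] at this
  have := le_posValue f (smul_nonneg (inv_nonneg.2 hc.le) hy) h
  rw [map_smul, smul_eq_mul, inv_mul_le_iff₀ hc] at this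
  exact this

theorem posValue_smul (f : Dual E) {c : ℝ} (hc : 0 < c) {x : E} (hx : 0 ≤ x) :
    posValue f (c • x) = c * posValue f x := by
  apply le_antisymm (posValue_smul_le f hc hx)
  have := posValue_smul_le f (inv_pos.2 hc) (smul_nonneg hc.le hx)
  rwa [inv_smul_smul₀ hc.ne', le_inv_mul_iff₀ hc] at this

/-- The extension of `posValue f` from the positive cone to `E` by differences. -/
def posFun (f : Dual E) (x : E) : ℝ := posValue f x⁺ - posValue f x⁻

theorem posFun_eq (f : Dual E) {x a b : E} (ha : 0 ≤ a) (hb : 0 ≤ b) (h : x = a - b) :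
    posFun f x = posValue f a - posValue f b := by
  have h₁ : x⁺ + b = a + x⁻ := by
    rw [← sub_eq_sub_iff_add_eq_add, posPart_sub_negPart, h]
  have h₂ := congrArg (posValue f) h₁
  rw [posValue_add f (posPart_nonneg x) hb, posValue_add f ha (negPart_nonneg x)] at h₂
  unfold posFun
  linarith

theorem posFun_of_nonneg (f : Dual E) {x : E} (hx : 0 ≤ x) : posFun f x = posValue f x := by
  have h₀ : posValue f (0 : E) = 0 :=
    le_antisymm (posValue_le le_rfl fun y hy hy' => by
      rw [le_antisymm hy' hy, map_zero]) (posValue_nonneg f le_rfl)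
  rw [posFun_eq f hx le_rfl (sub_zero x).symm, h₀, sub_zero]

theorem posFun_add (f : Dual E) (x y : E) : posFun f (x + y) = posFun f x + posFun f y := by
  rw [posFun_eq f (x := x + y) (add_nonneg (posPart_nonneg x) (posPart_nonneg y))
    (add_nonneg (negPart_nonneg x) (negPart_nonneg y)),
    posValue_add f (posPart_nonneg x) (posPart_nonneg y),
    posValue_add f (negPart_nonneg x) (negPart_nonneg y)]
  · unfold posFun
    ring
  · rw [add_sub_add_comm, posPart_sub_negPart, posPart_sub_negPart]

theorem posFun_smul (f : Dual E) (c : ℝ) (x : E) : posFun f (c • x) = c * posFun f x := by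
  have hp := posPart_nonneg x
  have hn := negPart_nonneg x
  rcases lt_trichotomy c 0 with hc | rfl | hc
  · have hc' : 0 < -c := neg_pos.2 hc
    rw [posFun_eq f (x := c • x) (smul_nonneg hc'.le hn) (smul_nonneg hc'.le hp),
      posValue_smul f hc' hn, posValue_smul f hc' hp]
    · unfold posFun
      ring
    · rw [← smul_sub, neg_smul, ← smul_neg, neg_sub, posPart_sub_negPart]
  · rw [zero_smul, zero_mul, posFun_eq f le_rfl le_rfl (sub_zero (0 : E)).symm, sub_self]
  · rw [posFun_eq f (x := c • x) (smul_nonneg hc.le hp) (smul_nonneg hc.le hn),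
      posValue_smul f hc hp, posValue_smul f hc hn]
    · unfold posFun
      ring
    · rw [← smul_sub, posPart_sub_negPart]

theorem abs_posFun_le (f : Dual E) (x : E) : |posFun f x| ≤ ‖f‖ * ‖x‖ := by
  have key : ∀ a : E, 0 ≤ a → ‖a‖ ≤ ‖x‖ → 0 ≤ posValue f a ∧ posValue f a ≤ ‖f‖ * ‖x‖ := by
    intro a ha hax
    refine ⟨posValue_nonneg f ha, posValue_le ha fun y hy hya => ?_⟩
    exact (le_of_mem_intervalValues ⟨y, ⟨hy, hya⟩, rfl⟩).trans
      (mul_le_mul_of_nonneg_left hax (norm_nonneg _))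
  have hp := key x⁺ (posPart_nonneg x) (norm_le_norm_of_abs_le_abs (by
    rw [abs_of_nonneg (posPart_nonneg x), ← posPart_add_negPart]
    exact le_add_of_nonneg_right (negPart_nonneg x)))
  have hn := key x⁻ (negPart_nonneg x) (norm_le_norm_of_abs_le_abs (by
    rw [abs_of_nonneg (negPart_nonneg x), ← posPart_add_negPart]
    exact le_add_of_nonneg_left (posPart_nonneg x)))
  unfold posFun
  rw [abs_le]
  constructor <;> linarith [hp.1, hp.2, hn.1, hn.2]

/-- The positive part of `f` in the dual, `f⁺ x = sup {f y | 0 ≤ y ≤ x}` for `x ≥ 0`. -/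
def Dual.pos (f : Dual E) : Dual E :=
  LinearMap.mkContinuous
    ({ toFun := posFun f, map_add' := posFun_add f, map_smul' := posFun_smul f } : E →ₗ[ℝ] ℝ)
    ‖f‖ (abs_posFun_le f)

theorem Dual.pos_apply (f : Dual E) {x : E} (hx : 0 ≤ x) : f.pos x = posValue f x :=
  posFun_of_nonneg f hx

theorem Dual.le_pos (f : Dual E) : f ≤ f.pos := fun x hx => by
  rw [f.pos_apply hx]
  exact le_posValue f hx le_rfl

theorem Dual.pos_nonneg (f : Dual E) : 0 ≤ f.pos := fun x hx => by
  rw [f.pos_apply hx]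
  exact posValue_nonneg f hx

theorem Dual.pos_le {f g : Dual E} (h : f ≤ g) (hg : 0 ≤ g) : f.pos ≤ g := fun x hx => by
  rw [f.pos_apply hx]
  refine posValue_le hx fun y hy hyx => (h y hy).trans ?_
  have := hg (x - y) (sub_nonneg.2 hyx)
  rw [Dual.zero_apply, map_sub] at this
  linarith

/-- The lattice structure of the dual, for the dual order: `f ⊔ g = (f - g)⁺ + g` and
`f ⊓ g = f - (f - g)⁺`. -/
instance : Lattice (Dual E) where
  sup f g := (f - g).pos + g
  inf f g := f - (f - g).pos
  le_sup_left f g := sub_le_iff_le_add.1 (f - g).le_pos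
  le_sup_right f g := le_add_of_nonneg_left (f - g).pos_nonneg
  sup_le _ g _ hf hg := le_sub_iff_add_le.1
    (Dual.pos_le (sub_le_sub_right hf g) (sub_nonneg.2 hg))
  inf_le_left f g := sub_le_self f (f - g).pos_nonneg
  inf_le_right f g := sub_le_comm.1 (f - g).le_pos
  le_inf _ f _ hf hg := le_sub_comm.1
    (Dual.pos_le (sub_le_sub_left hg f) (sub_nonneg.2 hf))

end DualLattice

/-- `E` is `σ`-order complete: every nonempty countable subset that is bounded above has a
supremum. -/
def IsSigmaOrderComplete (E : Type u) [Preorder E] : Prop :=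
  ∀ s : Set E, s.Countable → s.Nonempty → BddAbove s → ∃ a, IsLUB s a

/-- `F` is order continuous, that is, has order continuous norm: `D ↓ 0` implies `‖D‖ ↓ 0`,
for every nonempty downward directed set `D` with infimum `0`. -/
def IsOrderContinuous (F : Type u) [NormedAddCommGroup F] [Preorder F] : Prop :=
  ∀ D : Set F, D.Nonempty → DirectedOn (fun x y => y ≤ x) D → IsGLB D 0 →
    IsGLB (norm '' D) 0

section Convergence

variable {E : Type u} [NormedAddCommGroup E] [NormedSpace ℝ E]

/-- The sequence `f` in `E'` converges to `0` in the weak-star topology `σ(E', E)`. -/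
def IsWeakStarNull (f : ℕ → Dual E) : Prop :=
  ∀ x : E, Tendsto (fun n => f n x) atTop (𝓝 0)

/-- The sequence `f` in `E'` converges to `0` in the weak topology `σ(E', E'')`. -/
def IsWeaklyNull (f : ℕ → Dual E) : Prop :=
  ∀ φ : StrongDual ℝ (Dual E), Tendsto (fun n => φ (f n)) atTop (𝓝 0)

/-- The sequence `f` in `E'` is `uaw*`-null (unbounded weak-star convergent to `0`):
`|f n| ⊓ g` converges weak-star to `0` for each `g ≥ 0` in `E'`. -/
def IsUnboundedWeakStarNull [Lattice E] [IsOrderedAddMonoid E] [IsOrderedModule ℝ E]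
    [HasSolidNorm E] (f : ℕ → Dual E) : Prop :=
  ∀ g : Dual E, 0 ≤ g → IsWeakStarNull fun n => |f n| ⊓ g

end Convergence

/-- The positive Grothendieck property (PGP): every weak-star null sequence of positive
functionals is weakly null. -/
def HasPGP (E : Type u) [NormedAddCommGroup E] [NormedSpace ℝ E]
    [Lattice E] [IsOrderedAddMonoid E] [IsOrderedModule ℝ E] [HasSolidNorm E] : Prop :=
  ∀ f : ℕ → Dual E, (∀ n, 0 ≤ f n) → IsWeakStarNull f → IsWeaklyNull f

/-- The unbounded Grothendieck property (UGP): every norm bounded `uaw*`-null sequence of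
functionals is weakly null. -/
def HasUGP (E : Type u) [NormedAddCommGroup E] [NormedSpace ℝ E]
    [Lattice E] [IsOrderedAddMonoid E] [IsOrderedModule ℝ E] [HasSolidNorm E] : Prop :=
  ∀ f : ℕ → Dual E, (∃ C : ℝ, ∀ n, ‖f n‖ ≤ C) → IsUnboundedWeakStarNull f → IsWeaklyNull f

end BanachLattice

end

open Filter Topology

noncomputable section

namespace BanachLattice

universe u

variable {E : Type u} [NormedAddCommGroup E] [NormedSpace ℝ E]
  [Lattice E] [IsOrderedAddMonoid E] [IsOrderedModule ℝ E] [HasSolidNorm E]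

set_option linter.unusedSectionVars false

/-! ### Positive functionals and the Riesz–Kantorovich formula. -/

namespace Dual

/-! Forward direction: on an order continuous `E`, a bounded positive sequence `p n` with `p n ⊓ g`
weak* null for all `g ≥ 0` is itself weak* null (`isWeakStarNull_of_inf`); the PGP then applies to
the positive and negative parts of a bounded uaw*-null sequence. The proof is a gliding hump. If `p
n x` does not tend to `0`, smallness of the infimum with a large multiple of the functionals already
chosen yields `y k` in `[0, x]` on which the new functional is large and the old ones are tiny. The
tail suprema of `y` decrease, hence converge in norm, yet the chosen bounded functionals see a fixed
jump between consecutive ones.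

Converse: without order continuity some decreasing positive sequence has increments `u n` of norm at
least `ε`, with partial sums below some `x`. Functionals norming `u n`, restricted to the band of
`(u n - δ • x)⁺`, stay at least `ε / 2` at `x`. They are uaw*-null: the infimum with `h` is at most
the restriction of `h` to that band, whose value at `x` is at most `δ⁻¹ * h (u n)`, and the `h (u
n)` are summable. The cutoff by `δ • x` makes disjointness of the `u n` unnecessary. -/

theorem apply_mono {f : Dual E} (hf : 0 ≤ f) {x y : E} (h : x ≤ y) : f x ≤ f y := by
  have := hf (y - x) (sub_nonneg.2 h)
  rw [zero_apply, map_sub] at this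
  linarith

theorem apply_nonneg {f : Dual E} (hf : 0 ≤ f) {x : E} (h : 0 ≤ x) : 0 ≤ f x := hf x h

theorem inf_apply_le (f g : Dual E) {x y : E} (hy : 0 ≤ y) (hyx : y ≤ x) :
    (f ⊓ g) x ≤ f (x - y) + g y := by
  change f x - (f - g).pos x ≤ _
  have h := le_posValue (f - g) hy hyx
  rw [pos_apply _ (hy.trans hyx)]
  rw [sub_apply] at h
  rw [map_sub]
  linarith

/-- The infimum of two functionals at `x` is the infimum of `f (x - y) + g y` over splittings of
`x`, so a strict bound is witnessed by one splitting. -/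
theorem exists_apply_lt_of_inf_apply_lt {f g : Dual E} {x : E} (hx : 0 ≤ x) {c : ℝ}
    (h : (f ⊓ g) x < c) : ∃ y, 0 ≤ y ∧ y ≤ x ∧ f (x - y) + g y < c := by
  by_contra! H
  refine h.not_ge ?_
  change c ≤ f x - (f - g).pos x
  rw [pos_apply _ hx, le_sub_comm]
  refine posValue_le hx fun y hy hyx => ?_
  have := H y hy hyx
  rw [map_sub] at this
  rw [sub_apply]
  linarith

theorem pos_eq_posPart (f : Dual E) : f.pos = f⁺ :=
  le_antisymm (pos_le (le_posPart f) (posPart_nonneg f))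
    (sup_le f.le_pos f.pos_nonneg)

theorem norm_posPart_le (f : Dual E) : ‖f⁺‖ ≤ ‖f‖ := by
  rw [← pos_eq_posPart]
  exact LinearMap.mkContinuous_norm_le _ (norm_nonneg f) (abs_posFun_le f)

theorem norm_negPart_le (f : Dual E) : ‖f⁻‖ ≤ ‖f‖ := by
  rw [← posPart_neg]
  exact (norm_posPart_le _).trans_eq (norm_neg f)

theorem finset_sum_apply {ι : Type*} (s : Finset ι) (f : ι → Dual E) (x : E) :
    (∑ i ∈ s, f i) x = ∑ i ∈ s, f i x := by
  classical
  induction s using Finset.induction_on with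
  | empty => simp
  | insert a s ha ih => rw [Finset.sum_insert ha, Finset.sum_insert ha, add_apply, ih]

theorem apply_partialSups_le {f : Dual E} (hf : 0 ≤ f) {y : ℕ → E} (hy : ∀ n, 0 ≤ y n) (n : ℕ) :
    f (partialSups y n) ≤ ∑ i ∈ Finset.range (n + 1), f (y i) := by
  have h₀ : ∀ n, 0 ≤ partialSups y n := fun n => (hy 0).trans (le_partialSups_of_le y n.zero_le)
  induction n with
  | zero => simp
  | succ n ih =>
    rw [Finset.sum_range_succ, ← Order.succ_eq_add_one, partialSups_succ, Order.succ_eq_add_one]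
    have : f (partialSups y n ⊔ y (n + 1)) ≤ f (partialSups y n + y (n + 1)) :=
      apply_mono hf (sup_le (le_add_of_nonneg_right (hy _)) (le_add_of_nonneg_left (h₀ n)))
    rw [map_add] at this
    linarith

end Dual

/-! ### Monotone sequences under order continuity. -/

theorem IsOrderContinuous.tendsto_of_antitone (hoc : IsOrderContinuous E) {w : ℕ → E} {l : E}
    (hw : Antitone w) (hl : IsGLB (Set.range w) l) : Tendsto w atTop (𝓝 l) := by
  have hlw : ∀ n, l ≤ w n := fun n => hl.1 ⟨n, rfl⟩
  have h := hoc (Set.range fun n => w n - l) (Set.range_nonempty _) ?_ ?_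
  · rw [Metric.tendsto_atTop]
    intro ε hε
    obtain ⟨_, ⟨_, ⟨n, rfl⟩, rfl⟩, -, hn⟩ := h.exists_between hε
    refine ⟨n, fun m hm => ?_⟩
    rw [dist_eq_norm]
    refine lt_of_le_of_lt ?_ hn
    refine norm_le_norm_of_abs_le_abs ?_
    rw [abs_of_nonneg (sub_nonneg.2 (hlw m)), abs_of_nonneg (sub_nonneg.2 (hlw n))]
    exact sub_le_sub_right (hw hm) l
  · rintro _ ⟨m, rfl⟩ _ ⟨n, rfl⟩
    exact ⟨w (max m n) - l, ⟨_, rfl⟩, sub_le_sub_right (hw (le_max_left _ _)) l,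
      sub_le_sub_right (hw (le_max_right _ _)) l⟩
  · constructor
    · rintro _ ⟨n, rfl⟩
      exact sub_nonneg.2 (hlw n)
    · intro b hb
      have : b + l ≤ l := hl.2 (by
        rintro _ ⟨n, rfl⟩
        exact le_sub_iff_add_le.1 (hb ⟨n, rfl⟩))
      simpa using this

theorem IsOrderContinuous.tendsto_of_monotone (hoc : IsOrderContinuous E) {w : ℕ → E} {l : E}
    (hw : Monotone w) (hl : IsLUB (Set.range w) l) : Tendsto w atTop (𝓝 l) := by
  have h := hoc.tendsto_of_antitone (w := fun n => -w n) (l := -l)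
    (fun _ _ h => neg_le_neg (hw h)) ⟨?_, ?_⟩
  · simpa using h.neg
  · rintro _ ⟨n, rfl⟩
    exact neg_le_neg (hl.1 ⟨n, rfl⟩)
  · intro b hb
    refine le_neg_of_le_neg (hl.2 ?_)
    rintro _ ⟨n, rfl⟩
    exact le_neg_of_le_neg (hb ⟨n, rfl⟩)

theorem IsSigmaOrderComplete.exists_isGLB (hE : IsSigmaOrderComplete E) {w : ℕ → E}
    (hw : BddBelow (Set.range w)) : ∃ l, IsGLB (Set.range w) l := by
  obtain ⟨b, hb⟩ := hw
  obtain ⟨a, ha⟩ := hE (Set.range fun n => -w n) (Set.countable_range _) (Set.range_nonempty _)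
    ⟨-b, by
      rintro _ ⟨n, rfl⟩
      exact neg_le_neg (hb ⟨n, rfl⟩)⟩
  refine ⟨-a, ?_, fun c hc => ?_⟩
  · rintro _ ⟨n, rfl⟩
    exact neg_le_of_neg_le (ha.1 ⟨n, rfl⟩)
  · refine le_neg_of_le_neg (ha.2 ?_)
    rintro _ ⟨n, rfl⟩
    exact neg_le_neg (hc ⟨n, rfl⟩)

/-! ### The gliding hump and the forward direction. -/

/-- In a `σ`-order complete space with order continuous norm, there are no norm bounded positive
functionals `q k` and elements `y k` of `[0, x]` such that the `q k (y k)` stay away from `0` while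
`q k` is small on all later `y j`. -/
theorem not_apply_le_of_tail_small (hE : IsSigmaOrderComplete E) (hoc : IsOrderContinuous E)
    {q : ℕ → Dual E} {y : ℕ → E} {x : E} {C ε : ℝ} (hε : 0 < ε) (hq : ∀ k, 0 ≤ q k)
    (hC : ∀ k, ‖q k‖ ≤ C) (hy : ∀ k, 0 ≤ y k) (hyx : ∀ k, y k ≤ x)
    (hsmall : ∀ i k, i < k → q i (y k) ≤ ε * (1 / 2) ^ k) :
    ¬ ∀ k, 4 * ε ≤ q k (y k) := by
  intro hlarge
  have hlub : ∀ k, ∃ w, IsLUB (Set.range fun j => y (k + j)) w := fun k =>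
    hE _ (Set.countable_range _) (Set.range_nonempty _) ⟨x, by
      rintro _ ⟨j, rfl⟩
      exact hyx _⟩
  choose w hw using hlub
  have hyw : ∀ k, y k ≤ w k := fun k => (hw k).1 ⟨0, rfl⟩
  have hanti : Antitone w := antitone_nat_of_succ_le fun k => (hw (k + 1)).2 (by
    rintro _ ⟨j, rfl⟩
    exact (hw k).1 ⟨1 + j, by simp only [add_assoc]⟩)
  have hqw : ∀ k, q k (w (k + 1)) ≤ 2 * ε := by
    intro k
    -- Order continuity makes the tail supremum a norm limit of finite suprema, which `q k` bounds
    -- by finite sums.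
    have hlim : Tendsto (fun n => partialSups (fun j => y (k + 1 + j)) n) atTop (𝓝 (w (k + 1))) := by
      refine hoc.tendsto_of_monotone (partialSups_monotone _) ?_
      unfold IsLUB
      rw [upperBounds_range_partialSups]
      exact hw (k + 1)
    have hlim' := ((map_continuous (q k)).tendsto _).comp hlim
    refine le_of_tendsto' hlim' fun n => ?_
    refine (Dual.apply_partialSups_le (hq k) (fun j => hy _) n).trans ?_
    calc ∑ i ∈ Finset.range (n + 1), q k (y (k + 1 + i))
        ≤ ∑ i ∈ Finset.range (n + 1), ε * (1 / 2) ^ i := by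
          refine Finset.sum_le_sum fun i _ => (hsmall k _ (by omega)).trans ?_
          refine mul_le_mul_of_nonneg_left ?_ hε.le
          exact pow_le_pow_of_le_one (by norm_num) (by norm_num) (by omega)
      _ ≤ ε * 2 := by
          rw [← Finset.mul_sum]
          exact mul_le_mul_of_nonneg_left (sum_geometric_two_le _) hε.le
      _ = 2 * ε := mul_comm _ _
  obtain ⟨l, hl⟩ := hE.exists_isGLB (w := w) ⟨0, by
    rintro _ ⟨k, rfl⟩
    exact (hy k).trans (hyw k)⟩
  have hlim := hoc.tendsto_of_antitone hanti hl
  have hdiff : Tendsto (fun k => C * ‖w k - w (k + 1)‖) atTop (𝓝 0) := by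
    have := ((hlim.sub (hlim.comp (tendsto_add_atTop_nat 1))).norm).const_mul C
    simpa using this
  obtain ⟨k, hk⟩ := (hdiff.eventually (gt_mem_nhds hε)).exists
  have h₁ := Dual.apply_mono (hq k) (hyw k)
  have h₂ := (le_abs_self _).trans ((q k).le_opNorm (w k - w (k + 1)))
  have h₃ := mul_le_mul_of_nonneg_right (hC k) (norm_nonneg (w k - w (k + 1)))
  rw [map_sub] at h₂
  -- Here `2 * ε ≤ q k (w k - w (k + 1)) ≤ C * ‖w k - w (k + 1)‖ < ε`.
  linarith [hqw k, hlarge k]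

/-- If `p n ⊓ g` is weak-star null for all `g ≥ 0` and `p n x` does not tend to `0`, one can
choose members `q k` of the sequence and elements `y k` of `[0, x]` as in
`not_apply_le_of_tail_small`. -/
theorem exists_seq_tail_small {p : ℕ → Dual E} (hp : ∀ n, 0 ≤ p n)
    (hnull : ∀ g : Dual E, 0 ≤ g → IsWeakStarNull fun n => p n ⊓ g) {x : E} (hx : 0 ≤ x)
    {ε : ℝ} (hε : 0 < ε) (hfreq : ∃ᶠ n in atTop, 5 * ε ≤ p n x) :
    ∃ (a : ℕ → ℕ) (y : ℕ → E), (∀ k, 0 ≤ y k) ∧ (∀ k, y k ≤ x) ∧ (∀ k, 4 * ε ≤ p (a k) (y k)) ∧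
      ∀ i k, i < k → p (a i) (y k) ≤ ε * (1 / 2) ^ k := by
  -- A triple holds an index, its element `y` and a stage `m`; the stages strictly increase, so the
  -- `k`-th is at least `k`.
  obtain ⟨f, hP, hr⟩ := exists_seq_of_forall_finset_exists
    (α := ℕ × E × ℕ)
    (fun t => 0 ≤ t.2.1 ∧ t.2.1 ≤ x ∧ 4 * ε ≤ p t.1 t.2.1)
    (fun s t => s.2.2 < t.2.2 ∧ p s.1 t.2.1 ≤ ε * (1 / 2) ^ t.2.2) (by
      intro s _
      set m := s.sup (fun t => t.2.2) + 1
      set G : Dual E := ∑ t ∈ s, p t.1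
      have hG : 0 ≤ G := Finset.sum_nonneg fun t _ => hp t.1
      have hpow : (0 : ℝ) < (1 / 2) ^ m := by positivity
      -- The weight `2 ^ m` turns the bound `2 ^ m * G y < ε` into the required geometric decay.
      have hgG : (0 : Dual E) ≤ (2 ^ m : ℝ) • G := fun z hz => by
        rw [Dual.zero_apply, Dual.smul_apply]
        exact mul_nonneg (by positivity) (Dual.apply_nonneg hG hz)
      have hev := (hnull _ hgG x).eventually (gt_mem_nhds hε)
      obtain ⟨n, hn₁, hn₂⟩ := (hfreq.and_eventually hev).exists
      obtain ⟨y, hy, hyx, hlt⟩ := Dual.exists_apply_lt_of_inf_apply_lt hx hn₂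
      have hGy := Dual.apply_nonneg hG hy
      have hpy := Dual.apply_nonneg (hp n) (sub_nonneg.2 hyx)
      rw [Dual.smul_apply] at hlt
      refine ⟨(n, y, m), ⟨hy, hyx, ?_⟩, fun t ht => ⟨?_, ?_⟩⟩
      · have : 0 ≤ (2 : ℝ) ^ m * G y := by positivity
        rw [map_sub] at hlt
        change 4 * ε ≤ p n y
        linarith
      · exact Nat.lt_succ_of_le (Finset.le_sup (f := fun t : ℕ × E × ℕ => t.2.2) ht)
      · have h₁ : p t.1 y ≤ G y := by
          rw [Dual.finset_sum_apply]
          exact Finset.single_le_sum (f := fun t : ℕ × E × ℕ => p t.1 y)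
            (fun t _ => Dual.apply_nonneg (hp t.1) hy) ht
        refine h₁.trans ?_
        change G y ≤ ε * (1 / 2) ^ m
        rw [one_div, inv_pow, ← div_eq_mul_inv, le_div_iff₀ (by positivity)]
        linarith)
  have hmono : StrictMono fun k => (f k).2.2 := fun i k h => (hr i k h).1
  refine ⟨fun k => (f k).1, fun k => (f k).2.1, fun k => (hP k).1, fun k => (hP k).2.1,
    fun k => (hP k).2.2, fun i k h => (hr i k h).2.trans ?_⟩
  exact mul_le_mul_of_nonneg_left
    (pow_le_pow_of_le_one (by norm_num) (by norm_num) (hmono.le_apply)) hε.le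

theorem isWeakStarNull_of_inf (hE : IsSigmaOrderComplete E) (hoc : IsOrderContinuous E)
    {p : ℕ → Dual E} (hp : ∀ n, 0 ≤ p n) {C : ℝ} (hC : ∀ n, ‖p n‖ ≤ C)
    (hnull : ∀ g : Dual E, 0 ≤ g → IsWeakStarNull fun n => p n ⊓ g) : IsWeakStarNull p := by
  have key : ∀ x : E, 0 ≤ x → Tendsto (fun n => p n x) atTop (𝓝 0) := by
    intro x hx
    rw [tendsto_order]
    refine ⟨fun a ha => Eventually.of_forall fun n => ha.trans_le (Dual.apply_nonneg (hp n) hx),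
      fun a ha => ?_⟩
    by_contra hcon
    have hfreq : ∃ᶠ n in atTop, 5 * (a / 5) ≤ p n x := by
      rw [not_eventually] at hcon
      refine hcon.mono fun n hn => ?_
      linarith [not_lt.1 hn]
    obtain ⟨b, y, h₁, h₂, h₃, h₄⟩ := exists_seq_tail_small hp hnull hx (by positivity) hfreq
    exact not_apply_le_of_tail_small hE hoc (q := fun k => p (b k)) (by positivity : 0 < a / 5)
      (fun k => hp _) (fun k => hC _) h₁ h₂ h₄ h₃
  intro x
  have := (key x⁺ (posPart_nonneg x)).sub (key x⁻ (negPart_nonneg x))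
  rw [sub_zero] at this
  refine this.congr fun n => ?_
  rw [← map_sub, posPart_sub_negPart]

theorem HasPGP.hasUGP (hE : IsSigmaOrderComplete E) (hoc : IsOrderContinuous E)
    (hP : HasPGP E) : HasUGP E := by
  rintro f ⟨C, hC⟩ hf
  have key : ∀ p : ℕ → Dual E, (∀ n, 0 ≤ p n) → (∀ n, ‖p n‖ ≤ C) → (∀ n, p n ≤ |f n|) →
      IsWeaklyNull p := by
    intro p hp hpC hpf
    refine hP p hp (isWeakStarNull_of_inf hE hoc hp hpC fun g hg => ?_)
    have hnn : ∀ x : E, 0 ≤ x → Tendsto (fun n => (p n ⊓ g) x) atTop (𝓝 0) := fun x hx =>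
      squeeze_zero (fun n => Dual.apply_nonneg (le_inf (hp n) hg) hx)
        (fun n => inf_le_inf_right g (hpf n) x hx) (hf g hg x)
    intro x
    have := (hnn x⁺ (posPart_nonneg x)).sub (hnn x⁻ (negPart_nonneg x))
    rw [sub_zero] at this
    refine this.congr fun n => ?_
    rw [← map_sub, posPart_sub_negPart]
  intro φ
  have h₁ := key (fun n => (f n)⁺) (fun n => posPart_nonneg _)
    (fun n => (Dual.norm_posPart_le _).trans (hC n))
    (fun n => by
      rw [← posPart_add_negPart]
      exact le_add_of_nonneg_right (negPart_nonneg _)) φ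
  have h₂ := key (fun n => (f n)⁻) (fun n => negPart_nonneg _)
    (fun n => (Dual.norm_negPart_le _).trans (hC n))
    (fun n => by
      rw [← posPart_add_negPart]
      exact le_add_of_nonneg_left (posPart_nonneg _)) φ
  have := h₁.sub h₂
  rw [sub_zero] at this
  refine this.congr fun n => ?_
  rw [← map_sub, posPart_sub_negPart]

/-! ### Restriction of functionals to principal bands. -/

theorem add_inf_le_inf_add_inf {a b c : E} (ha : 0 ≤ a) (hb : 0 ≤ b) (hc : 0 ≤ c) :
    (a + b) ⊓ c ≤ a ⊓ c + b ⊓ c := by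
  have h₁ : (a + b) ⊓ c ≤ a + b ⊓ c := by
    rw [add_inf]
    exact inf_le_inf_left _ (le_add_of_nonneg_left ha)
  have h₂ : (a + b) ⊓ c ≤ c + b ⊓ c :=
    inf_le_right.trans (le_add_of_nonneg_right (le_inf hb hc))
  rw [inf_add]
  exact le_inf h₁ h₂

theorem inf_nsmul_eq_zero {a b : E} (ha : 0 ≤ a) (hb : 0 ≤ b) (h : a ⊓ b = 0) (k : ℕ) :
    a ⊓ k • b = 0 := by
  induction k with
  | zero => simpa using ha
  | succ k ih =>
    refine le_antisymm ?_ (le_inf ha (nsmul_nonneg hb _))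
    rw [succ_nsmul, inf_comm]
    refine (add_inf_le_inf_add_inf (nsmul_nonneg hb _) hb ha).trans ?_
    rw [inf_comm, ih, inf_comm, h, add_zero]

/-- A positive additive function on the positive cone, dominated by a positive functional,
extends to a functional. -/
theorem exists_dual_of_additive_on_nonneg (q : E → ℝ) {f : Dual E} (hq₀ : ∀ x, 0 ≤ x → 0 ≤ q x)
    (hqf : ∀ x, 0 ≤ x → q x ≤ f x)
    (hadd : ∀ x y, 0 ≤ x → 0 ≤ y → q (x + y) = q x + q y) :
    ∃ g : Dual E, ∀ x, 0 ≤ x → g x = q x := by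
  have hdiff : ∀ a b c d : E, 0 ≤ a → 0 ≤ b → 0 ≤ c → 0 ≤ d → a - b = c - d →
      q a - q b = q c - q d := by
    intro a b c d ha hb hc hd h
    have := congrArg q (sub_eq_sub_iff_add_eq_add.1 h)
    rw [hadd _ _ ha hd, hadd _ _ hc hb] at this
    linarith
  let G : E →+ ℝ := AddMonoidHom.mk' (fun x => q x⁺ - q x⁻) fun x y => by
    rw [hdiff _ _ (x⁺ + y⁺) (x⁻ + y⁻) (posPart_nonneg _) (negPart_nonneg _)
      (add_nonneg (posPart_nonneg _) (posPart_nonneg _))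
      (add_nonneg (negPart_nonneg _) (negPart_nonneg _)),
      hadd _ _ (posPart_nonneg _) (posPart_nonneg _), hadd _ _ (negPart_nonneg _) (negPart_nonneg _)]
    · ring
    · rw [add_sub_add_comm, posPart_sub_negPart, posPart_sub_negPart, posPart_sub_negPart]
  have hbound : ∀ x, ‖G x‖ ≤ ‖f‖ * ‖x‖ := by
    intro x
    have h₁ := hq₀ _ (posPart_nonneg x)
    have h₂ := hq₀ _ (negPart_nonneg x)
    have h₃ := hqf _ (posPart_nonneg x)
    have h₄ := hqf _ (negPart_nonneg x)
    have h₅ := (le_abs_self _).trans (f.le_opNorm |x|)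
    rw [norm_abs_eq_norm, ← posPart_add_negPart, map_add] at h₅
    change |q x⁺ - q x⁻| ≤ _
    rw [abs_le]
    constructor <;> linarith
  have hcont : Continuous G := AddMonoidHomClass.continuous_of_bound G ‖f‖ hbound
  refine ⟨(G.toRealLinearMap hcont : E →L[ℝ] ℝ), fun x hx => ?_⟩
  change q x⁺ - q x⁻ = q x
  have h₀ : q 0 = 0 := by simpa using hadd 0 0 le_rfl le_rfl
  rw [posPart_of_nonneg hx, negPart_of_nonneg hx, h₀, sub_zero]

/-- `g y = sup_k f (y ⊓ k • v)` for all `y ≥ 0`: the functional `g` is the restriction of `f` to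
the band generated by `v`. -/
structure IsBandRestriction (g f : Dual E) (v : E) : Prop where
  le : ∀ (k : ℕ) (y : E), 0 ≤ y → f (y ⊓ k • v) ≤ g y
  lt : ∀ y : E, 0 ≤ y → ∀ ε : ℝ, 0 < ε → ∃ k : ℕ, g y < f (y ⊓ k • v) + ε

theorem exists_isBandRestriction {f : Dual E} (hf : 0 ≤ f) {v : E} (hv : 0 ≤ v) :
    ∃ g : Dual E, IsBandRestriction g f v := by
  have hbdd : ∀ y : E, BddAbove (Set.range fun k : ℕ => f (y ⊓ k • v)) := fun y => ⟨f y, by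
    rintro _ ⟨k, rfl⟩
    exact Dual.apply_mono hf inf_le_left⟩
  have hle : ∀ (y : E) (k : ℕ), f (y ⊓ k • v) ≤ ⨆ k : ℕ, f (y ⊓ k • v) := fun y k =>
    le_ciSup (hbdd y) k
  obtain ⟨g, hg⟩ := exists_dual_of_additive_on_nonneg (fun y => ⨆ k : ℕ, f (y ⊓ k • v)) (f := f)
    (fun y hy => by simpa [hy] using hle y 0)
    (fun y hy => ciSup_le fun k => Dual.apply_mono hf inf_le_left)
    (fun x y hx hy => by
      apply le_antisymm
      · refine ciSup_le fun k => ?_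
        have := Dual.apply_mono hf (add_inf_le_inf_add_inf hx hy (nsmul_nonneg hv k))
        rw [map_add] at this
        linarith [hle x k, hle y k]
      · rw [← le_sub_iff_add_le]
        refine ciSup_le fun k => ?_
        rw [le_sub_comm]
        refine ciSup_le fun l => ?_
        -- Independent `k` and `l` are absorbed by `k + l`, which gives superadditivity.
        have h : x ⊓ k • v + y ⊓ l • v ≤ (x + y) ⊓ (k + l) • v := by
          rw [add_nsmul]
          exact le_inf (add_le_add inf_le_left inf_le_left) (add_le_add inf_le_right inf_le_right)
        have := Dual.apply_mono hf h
        rw [map_add] at this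
        linarith [hle (x + y) (k + l)])
  refine ⟨g, fun k y hy => ?_, fun y hy ε hε => ?_⟩
  · rw [hg y hy]
    exact hle y k
  · obtain ⟨k, hk⟩ := exists_lt_of_lt_ciSup (sub_lt_self (⨆ k : ℕ, f (y ⊓ k • v)) hε)
    exact ⟨k, by rw [hg y hy]; linarith⟩

namespace IsBandRestriction

variable {f g h : Dual E} {v w : E}

theorem nonneg (hg : IsBandRestriction g f v) : 0 ≤ g := fun y hy => by
  simpa [hy] using hg.le 0 y hy

theorem le_functional (hg : IsBandRestriction g f v) (hf : 0 ≤ f) : g ≤ f := fun y hy => by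
  refine le_of_forall_pos_le_add fun ε hε => ?_
  obtain ⟨k, hk⟩ := hg.lt y hy ε hε
  linarith [Dual.apply_mono hf (inf_le_left : y ⊓ k • v ≤ y)]

theorem mono (hg : IsBandRestriction g f v) (hh : IsBandRestriction h f w) (hf : 0 ≤ f)
    (hvw : v ≤ w) : g ≤ h := fun y hy => by
  refine le_of_forall_pos_le_add fun ε hε => ?_
  obtain ⟨k, hk⟩ := hg.lt y hy ε hε
  have := Dual.apply_mono hf (inf_le_inf_left y (nsmul_le_nsmul_right hvw k))
  linarith [hh.le k y hy]

theorem apply_eq_zero (hg : IsBandRestriction g f v) (hv : 0 ≤ v) {y : E} (hy : 0 ≤ y)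
    (hyv : y ⊓ v = 0) : g y = 0 := by
  refine le_antisymm (le_of_forall_pos_le_add fun ε hε => ?_) (Dual.apply_nonneg hg.nonneg hy)
  obtain ⟨k, hk⟩ := hg.lt y hy ε hε
  rw [inf_nsmul_eq_zero hy hv hyv, map_zero] at hk
  exact hk.le

/-- The restriction vanishes on `w⁻`, which is disjoint from `w⁺`. With `w = u - δ • x` this reads
`δ * g x ≤ g u`. -/
theorem apply_nonneg_of_posPart {w : E} (hg : IsBandRestriction g f w⁺) : 0 ≤ g w := by
  have h := hg.apply_eq_zero (posPart_nonneg w) (negPart_nonneg w)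
    (by rw [inf_comm, posPart_inf_negPart_eq_zero])
  rw [← posPart_sub_negPart w, map_sub, h, sub_zero]
  exact Dual.apply_nonneg hg.nonneg (posPart_nonneg w)

theorem le_apply (hg : IsBandRestriction g f v) {y : E} (hy : 0 ≤ y) (hyv : y ≤ v) :
    f y ≤ g y := by
  simpa [hyv] using hg.le 1 y hy

/-- Split `y` at `z = y ⊓ k • v`: for large `k`, `g` is small on `y - z`, while `f' z ≤ g' y`. -/
theorem inf_apply_le {f' g' : Dual E} (hg : IsBandRestriction g f v)
    (hg' : IsBandRestriction g' f' v) (hv : 0 ≤ v) {y : E} (hy : 0 ≤ y) :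
    (g ⊓ f') y ≤ g' y := by
  refine le_of_forall_pos_le_add fun ε hε => ?_
  obtain ⟨k, hk⟩ := hg.lt y hy ε hε
  have hz : 0 ≤ y ⊓ k • v := le_inf hy (nsmul_nonneg hv k)
  have h₁ := Dual.inf_apply_le g f' hz inf_le_left
  have h₂ := hg.le k _ hz
  rw [inf_assoc, inf_idem] at h₂
  rw [map_sub] at h₁
  linarith [hg'.le k y hy]

end IsBandRestriction

/-! ### Failure of order continuity and the converse. -/

theorem Dual.norm_le_of_le {f g : Dual E} (hg : 0 ≤ g) (hgf : g ≤ f) : ‖g‖ ≤ ‖f‖ := by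
  refine ContinuousLinearMap.opNorm_le_bound (show StrongDual ℝ E from g) (norm_nonneg f)
    fun x => ?_
  have h₁ := Dual.apply_mono hg (le_abs_self x)
  have h₂ := Dual.apply_mono hg (neg_le_abs x)
  have h₃ := hgf |x| (abs_nonneg x)
  have h₄ := (le_abs_self _).trans (f.le_opNorm |x|)
  rw [norm_abs_eq_norm] at h₄
  rw [map_neg] at h₂
  change |g x| ≤ _
  rw [abs_le]
  constructor <;> linarith

theorem Dual.exists_nonneg_norm_le_one (x : E) :
    ∃ f : Dual E, 0 ≤ f ∧ ‖f‖ ≤ 1 ∧ (0 ≤ x → ‖x‖ ≤ f x) := by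
  obtain ⟨g, hg, hgx⟩ := exists_dual_vector'' ℝ x
  let g' : Dual E := g
  refine ⟨g'⁺, posPart_nonneg g', (Dual.norm_posPart_le g').trans hg, fun hx => ?_⟩
  have : g' x ≤ g'⁺ x := le_posPart g' x hx
  exact (show ‖x‖ = g' x from hgx.symm).trans_le this

/-- Restrictions of a positive functional `h` to the bands generated by `(u n - δ x)⁺`, where
the `u n ≥ 0` have partial sums below `x`, tend weak-star to `0`. -/
theorem tendsto_bandRestriction_apply {h : Dual E} (hh : 0 ≤ h) {u : ℕ → E} {x : E} {δ : ℝ}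
    (hδ : 0 < δ) (hu : ∀ n, 0 ≤ u n) (hx : 0 ≤ x)
    (hsum : ∀ n, ∑ i ∈ Finset.range n, u i ≤ x) {H : ℕ → Dual E}
    (hH : ∀ n, IsBandRestriction (H n) h (u n - δ • x)⁺) {y : E} (hy : 0 ≤ y) :
    Tendsto (fun n => H n y) atTop (𝓝 0) := by
  have hux : ∀ n, u n ≤ x := fun n =>
    (Finset.single_le_sum (fun i _ => hu i) (Finset.self_mem_range_succ n)).trans (hsum (n + 1))
  have hhu : Tendsto (fun n => h (u n)) atTop (𝓝 0) := by
    refine (summable_of_sum_range_le (c := h x) (fun n => Dual.apply_nonneg hh (hu n))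
      fun n => ?_).tendsto_atTop_zero
    rw [← map_sum]
    exact Dual.apply_mono hh (hsum n)
  have hHx : Tendsto (fun n => H n x) atTop (𝓝 0) := by
    refine squeeze_zero (g := fun n => δ⁻¹ * h (u n))
      (fun n => Dual.apply_nonneg (hH n).nonneg hx) (fun n => ?_)
      (by simpa using hhu.const_mul δ⁻¹)
    have h₁ := (hH n).apply_nonneg_of_posPart
    have h₂ := (hH n).le_functional hh (u n) (hu n)
    rw [map_sub, map_smul, smul_eq_mul] at h₁
    rw [le_inv_mul_iff₀ hδ]
    linarith
  -- `K` dominates every `H n`, so it bounds the error from replacing `y` by `y ⊓ m • x` uniformly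
  -- in `n`.
  obtain ⟨K, hK⟩ := exists_isBandRestriction hh hx
  rw [tendsto_order]
  refine ⟨fun a ha => Eventually.of_forall fun n => ha.trans_le (Dual.apply_nonneg (hH n).nonneg hy),
    fun a ha => ?_⟩
  obtain ⟨m, hm⟩ := hK.lt y hy (a / 2) (by positivity)
  have hev : ∀ᶠ n in atTop, (m : ℝ) * H n x < a / 2 :=
    (hHx.const_mul (m : ℝ)).eventually (gt_mem_nhds (by simpa using ha))
  filter_upwards [hev] with n hn
  set z := y ⊓ m • x
  have hz : 0 ≤ z := le_inf hy (nsmul_nonneg hx m)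
  have h₁ : H n z ≤ m * H n x := by
    have := Dual.apply_mono (hH n).nonneg (inf_le_right : z ≤ m • x)
    rwa [map_nsmul, nsmul_eq_mul] at this
  have hv : (u n - δ • x)⁺ ≤ x :=
    sup_le ((sub_le_self _ (smul_nonneg hδ.le hx)).trans (hux n)) hx
  have h₂ := (hH n).mono hK hh hv (y - z) (sub_nonneg.2 inf_le_left)
  have h₃ := hK.le m z hz
  rw [inf_assoc, inf_idem] at h₃
  rw [map_sub, map_sub] at h₂
  linarith

/-- Otherwise every directed `D` with infimum `0` contains a decreasing sequence below whose terms
`D` has vanishing oscillation. It is Cauchy, and its limit is a lower bound of `D`, hence `0`. -/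
theorem exists_antitone_of_not_isOrderContinuous [CompleteSpace E]
    (h : ¬ IsOrderContinuous E) :
    ∃ ε : ℝ, 0 < ε ∧ ∃ d : ℕ → E, (∀ n, 0 ≤ d n) ∧ Antitone d ∧
      ∀ n, ε ≤ ‖d n - d (n + 1)‖ := by
  by_contra hcon
  refine h fun D hne hdir hglb => ?_
  have hsmall : ∀ ε : ℝ, 0 < ε → ∀ d₀ ∈ D, ∃ d ∈ D, d ≤ d₀ ∧ ∀ d' ∈ D, d' ≤ d → ‖d - d'‖ < ε := by
    intro ε hε d₀ hd₀
    by_contra! H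
    refine hcon ⟨ε, hε, ?_⟩
    have H' : ∀ d : {d // d ∈ D ∧ d ≤ d₀}, ∃ d' : {d // d ∈ D ∧ d ≤ d₀},
        d'.1 ≤ d.1 ∧ ε ≤ ‖d.1 - d'.1‖ := fun d => by
      obtain ⟨d', h₁, h₂, h₃⟩ := H d.1 d.2.1 d.2.2
      exact ⟨⟨d', h₁, h₂.trans d.2.2⟩, h₂, h₃⟩
    choose next hn₁ hn₂ using H'
    let s : ℕ → {d // d ∈ D ∧ d ≤ d₀} := fun n => next^[n] ⟨d₀, hd₀, le_rfl⟩
    have hs : ∀ n, s (n + 1) = next (s n) := fun n => Function.iterate_succ_apply' _ _ _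
    refine ⟨fun n => (s n).1, fun n => hglb.1 (s n).2.1, antitone_nat_of_succ_le fun n => ?_,
      fun n => ?_⟩
    · rw [hs]
      exact hn₁ _
    · beta_reduce
      rw [hs]
      exact hn₂ _
  obtain ⟨d₀, hd₀⟩ := hne
  have hstep : ∀ (n : ℕ) (d₁ : D), ∃ d : D, d.1 ≤ d₁.1 ∧
      ∀ d' ∈ D, d' ≤ d.1 → ‖d.1 - d'‖ < 1 / ((n : ℝ) + 1) := fun n d₁ => by
    obtain ⟨d, h₁, h₂, h₃⟩ := hsmall (1 / ((n : ℝ) + 1)) Nat.one_div_pos_of_nat d₁.1 d₁.2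
    exact ⟨⟨d, h₁⟩, h₂, h₃⟩
  choose next hn₁ hn₂ using hstep
  let e : ℕ → D := fun n => Nat.rec (next 0 ⟨d₀, hd₀⟩) (fun n d => next (n + 1) d) n
  have he : ∀ n, ∀ d' ∈ D, d' ≤ (e n).1 → ‖(e n).1 - d'‖ < 1 / ((n : ℝ) + 1) := by
    intro n
    cases n with
    | zero => exact hn₂ 0 _
    | succ n => exact hn₂ (n + 1) (e n)
  have hanti : Antitone fun n => (e n).1 := antitone_nat_of_succ_le fun n => hn₁ (n + 1) (e n)
  have hcau : CauchySeq fun n => (e n).1 := by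
    refine cauchySeq_of_le_tendsto_0' (fun n : ℕ => 1 / ((n : ℝ) + 1)) (fun n m hnm => ?_)
      tendsto_one_div_add_atTop_nhds_zero_nat
    rw [dist_eq_norm]
    exact (he n _ (e m).2 (hanti hnm)).le
  obtain ⟨l, hl⟩ := cauchySeq_tendsto_of_complete hcau
  have hl₀ : 0 ≤ l := ge_of_tendsto' hl fun n => hglb.1 (e n).2
  have hlD : l ∈ lowerBounds D := by
    intro d hd
    -- Elements `c n` of `D` below both `e n` and `d` have the same limit `l`, so `l ≤ d`.
    choose c hcD hc₁ hc₂ using fun n => hdir _ (e n).2 d hd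
    have hlim : Tendsto (fun n => (e n).1 - c n) atTop (𝓝 0) :=
      squeeze_zero_norm (fun n => (he n _ (hcD n) (hc₁ n)).le)
        tendsto_one_div_add_atTop_nhds_zero_nat
    have := hl.sub hlim
    simp only [sub_sub_cancel, sub_zero] at this
    exact le_of_tendsto' this hc₂
  obtain rfl : l = 0 := le_antisymm (hglb.2 hlD) hl₀
  refine ⟨?_, fun b hb => ?_⟩
  · rintro _ ⟨d, -, rfl⟩
    exact norm_nonneg d
  · have hlim := hl.norm
    rw [norm_zero] at hlim
    exact ge_of_tendsto' hlim fun n => hb ⟨_, (e n).2, rfl⟩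

theorem HasUGP.isOrderContinuous [CompleteSpace E] (hU : HasUGP E) : IsOrderContinuous E := by
  by_contra hcon
  obtain ⟨ε, hε, d, hd, hanti, hgap⟩ := exists_antitone_of_not_isOrderContinuous hcon
  set x := d 0
  have hx : 0 ≤ x := hd 0
  set u : ℕ → E := fun n => d n - d (n + 1)
  have hu : ∀ n, 0 ≤ u n := fun n => sub_nonneg.2 (hanti n.le_succ)
  have hsum : ∀ n, ∑ i ∈ Finset.range n, u i ≤ x := fun n => by
    rw [Finset.sum_range_sub']
    exact sub_le_self _ (hd n)
  -- Cutting off `δ • x` then costs a norm-one functional at most half of `ε`.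
  obtain ⟨δ, hδ, hδx⟩ : ∃ δ : ℝ, 0 < δ ∧ δ * ‖x‖ ≤ ε / 2 := by
    refine ⟨ε / 2 / (‖x‖ + 1), by positivity, ?_⟩
    rw [div_mul_eq_mul_div, div_le_iff₀ (by positivity)]
    exact mul_le_mul_of_nonneg_left (by linarith) (by positivity)
  set v : ℕ → E := fun n => (u n - δ • x)⁺
  have hv : ∀ n, 0 ≤ v n := fun n => posPart_nonneg _
  choose f hf₀ hf₁ hfu using fun n => Dual.exists_nonneg_norm_le_one (u n)
  choose g hg using fun n => exists_isBandRestriction (hf₀ n) (hv n)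
  have hgle : ∀ n, ‖g n‖ ≤ 1 := fun n =>
    (Dual.norm_le_of_le (hg n).nonneg ((hg n).le_functional (hf₀ n))).trans (hf₁ n)
  have hnull : IsUnboundedWeakStarNull g := by
    intro h hh
    choose H hH using fun n => exists_isBandRestriction hh (hv n)
    have hnn : ∀ y : E, 0 ≤ y → Tendsto (fun n => (|g n| ⊓ h) y) atTop (𝓝 0) := fun y hy =>
      squeeze_zero
        (fun n => Dual.apply_nonneg (le_inf (abs_nonneg _) hh) hy)
        (fun n => by
          rw [abs_of_nonneg (hg n).nonneg]
          exact (hg n).inf_apply_le (hH n) (hv n) hy)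
        (tendsto_bandRestriction_apply hh hδ hu hx hsum hH hy)
    intro y
    have := (hnn y⁺ (posPart_nonneg y)).sub (hnn y⁻ (negPart_nonneg y))
    rw [sub_zero] at this
    refine this.congr fun n => ?_
    rw [← map_sub, posPart_sub_negPart]
  -- Evaluation at `x` is the element of the bidual that detects the contradiction.
  have hlim := hU g ⟨1, hgle⟩ hnull (ContinuousLinearMap.apply ℝ ℝ x : StrongDual ℝ (StrongDual ℝ E))
  have hlow : ∀ n, ε / 2 ≤ g n x := by
    intro n
    have hvx : v n ≤ x := sup_le ((sub_le_self _ (smul_nonneg hδ.le hx)).trans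
      (sub_le_self (d n) (hd _) |>.trans (hanti n.zero_le))) hx
    have h₁ := Dual.apply_mono (hg n).nonneg hvx
    have h₂ := (hg n).le_apply (hv n) le_rfl
    have h₃ := Dual.apply_mono (hf₀ n) (le_posPart (u n - δ • x))
    rw [map_sub, map_smul, smul_eq_mul] at h₃
    have h₄ := hfu n (hu n)
    have h₅ : f n x ≤ ‖x‖ := (le_abs_self _).trans (((f n).le_opNorm x).trans
      (mul_le_of_le_one_left (norm_nonneg x) (hf₁ n)))
    have h₆ := mul_le_mul_of_nonneg_left h₅ hδ.le
    have h₇ : ε ≤ ‖u n‖ := hgap n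
    change f n (v n) ≤ _ at h₂
    change _ ≤ f n (v n) at h₃
    linarith
  have : ε / 2 ≤ 0 := ge_of_tendsto' hlim hlow
  linarith

end BanachLattice

end

theorem mainTheorem2 (E : Type*) [NormedAddCommGroup E] [NormedSpace ℝ E] [CompleteSpace E]
    [Lattice E] [IsOrderedAddMonoid E] [IsOrderedModule ℝ E] [HasSolidNorm E]
    (hE : BanachLattice.IsSigmaOrderComplete E)
    (hE' : BanachLattice.IsOrderContinuous (BanachLattice.Dual E)) :
    (BanachLattice.IsOrderContinuous E → BanachLattice.HasPGP E → BanachLattice.HasUGP E) ∧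
      (BanachLattice.HasUGP E → BanachLattice.IsOrderContinuous E) :=
  ⟨fun hoc hP => hP.hasUGP hE hoc, fun hU => hU.isOrderContinuous⟩
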